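/- For $L_{xy},\mu_x,\mu_y>0$ write $\theta=(L_{xy},\mu_x,\mu_y)$, and let $\mathcal B(\theta)$ be the class of problems $\min_x\max_y\, f(x)+x^\top My-g(y)$ with $f$ lower semicontinuous and $\mu_x$-strongly convex, $g$ lower semicontinuous and $\mu_y$-strongly convex, and $\|M\|_2\le L_{xy}$. A (deterministic) algorithm $\mathcal A$ of the general proximal class on $\mathbb R^n\times\mathbb R^n$ consists of step sizes $\gamma_k,\sigma_k>0$ (which may depend on $\theta$) and arbitrary mappings $\mathcal A_u^k,\mathcal A_v^k,\mathcal A_x^k,\mathcal A_y^k$, $k\ge1$ (no linear-span assumption). Applied to such a problem from $(x^0,y^0)$ it generates iterates $(x^k,y^k)$ and outputs $(\tilde x^k,\tilde y^k)$ by $$(x^k,\tilde x^k)=\mathcal A_x^k\big(\theta;x^0,My^0,\dots,x^{k-1},My^{k-1};\mathrm{prox}_{\gamma_kf}(u^k)\big),\qquad (y^k,\tilde y^k)=\mathcal A_y^k\big(\theta;y^0,M^\top x^0,\dots,y^{k-1},M^\top x^{k-1};\mathrm{prox}_{\sigma_kg}(v^k)\big),$$ with $u^k=\mathcal A_u^k(\theta;x^0,My^0,\dots,x^{k-1},My^{k-1})$,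 $v^k=\mathcal A_v^k(\theta;y^0,M^\top x^0,\dots,y^{k-1},M^\top x^{k-1})$ and $\mathrm{prox}_{\gamma h}(w)=\arg\min_z h(z)+\frac1{2\gamma}\|z-w\|^2$; put $(\tilde x^0,\tilde y^0)=(x^0,y^0)$. Let $A\in\mathbb R^{n\times n}$ have entries $A_{ij}=1$ if $i+j=n+1$, $A_{ij}=-1$ if $i+j=n+2$, and $0$ otherwise; let $b=-\frac{L_{xy}^2}{4\mu_x}e_1$ and $$F(x,y)=\tfrac{\mu_x}2\|x\|^2+\tfrac{L_{xy}}2x^\top Ay-\tfrac{\mu_y}2\|y\|^2-b^\top y,\qquad F_{U,V}(x,y)=F(Ux,Vy)$$ for orthogonal $U,V\in\mathbb R^{n\times n}$. Let $\mathcal H_x^m=\mathrm{Span}\{A^{2i}(Ab):0\le i\le\lfloor m/2\rfloor-1\}$ and $\mathcal H_y^m=\mathrm{Span}\{A^{2i}b:0\le i\le\lceil m/2\rceil-1\}$ (an empty span is $\{0\}$), and $$q=1+\tfrac{2\mu_x\mu_y}{L_{xy}^2}-2\sqrt{\big(\tfrac{\mu_x\mu_y}{L_{xy}^2}\big)^2+\tfrac{\mu_x\mu_y}{L_{xy}^2}}.$$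 **(i)** Let $L_{xy},\mu_x,\mu_y>0$ and let $k\ge0$ be an integer. For all $n$ that are sufficiently large (depending only on $\theta$ and $k$), $F$ has a unique saddle point $(x^*,y^*)$, and for every algorithm $\mathcal A$ of the general proximal class on $\mathbb R^n\times\mathbb R^n$ there are orthogonal matrices $U,V$ such that $F_{U,V}\in\mathcal B(\theta)$, the unique saddle point of $F_{U,V}$ is $(U^\top x^*,V^\top y^*)$, and, when $\mathcal A$ is applied to $F_{U,V}$ from $(x^0,y^0)=(0,0)$, $$\{(x^0,y^0),\dots,(x^k,y^k)\}\subseteq U^\top\mathcal H_x^{4k-1}\times V^\top\mathcal H_y^{4k-1},\qquad(\tilde x^k,\tilde y^k)\in U^\top\mathcal H_x^{4k+1}\times V^\top\mathcal H_y^{4k+1},$$ $$\|\tilde y^k-V^\top y^*\|^2\ \ge\ \frac{q^{4k+2}}{16}\|y^*-y^0\|^2 .$$ **(ii)** It takes $\Omega\big(\sqrt{L_{xy}^2/(\mu_x\mu_y)}\,\log(1/\epsilon)\big)$ iterations to output a point with $O(\epsilon)$ duality gap. That is, there is an absolute constant $c>0$ such that for all $L_{xy},\mu_x,\mu_y,C>0$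 there is $\epsilon_0>0$ such that for every $\epsilon\in(0,\epsilon_0)$, every sufficiently large $n$ (depending only on $\theta,C,\epsilon$) and every algorithm $\mathcal A$ of the general proximal class on $\mathbb R^n\times\mathbb R^n$ there are orthogonal $U,V$ with $F_{U,V}\in\mathcal B(\theta)$ such that, when $\mathcal A$ is applied to $F_{U,V}$ from $(0,0)$, every $k\ge0$ with $$\max_{y}F_{U,V}(\tilde x^k,y)-\min_{x}F_{U,V}(x,\tilde y^k)\le C\epsilon$$ satisfies $k\ge c\sqrt{\frac{L_{xy}^2}{\mu_x\mu_y}}\,\log\frac1\epsilon$. -/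

import Mathlib

namespace SaddleProx

/-- The parameters `θ = (L_xy, μ_x, μ_y)` of the bilinear problem class. -/
structure ClassParams where
  Lxy : ℝ
  μx : ℝ
  μy : ℝ

section General

variable {X Y : Type*} [NormedAddCommGroup X] [InnerProductSpace ℝ X] [CompleteSpace X]
  [NormedAddCommGroup Y] [InnerProductSpace ℝ Y]

/-- A bilinearly coupled problem `min_x max_y F(x,y) = f(x) + ⟨x, A y⟩ - g(y)`. -/
structure BilinearProblem (X Y : Type*) [NormedAddCommGroup X] [InnerProductSpace ℝ X]
    [NormedAddCommGroup Y] [InnerProductSpace ℝ Y] where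
  f : X → ℝ
  A : Y →L[ℝ] X
  g : Y → ℝ

/-- The objective `F(x,y) = f(x) + ⟨x, A y⟩ - g(y)`. -/
noncomputable def BilinearProblem.value (P : BilinearProblem X Y) (x : X) (y : Y) : ℝ :=
  P.f x + inner ℝ x (P.A y) - P.g y

/-- Membership in the class `B(L_xy, μ_x, μ_y)`; `‖P.A‖` is the operator (spectral) norm. -/
def BilinearProblem.InClass (P : BilinearProblem X Y) (θ : ClassParams) : Prop :=
  LowerSemicontinuous P.f ∧ StrongConvexOn Set.univ θ.μx P.f ∧
  LowerSemicontinuous P.g ∧ StrongConvexOn Set.univ θ.μy P.g ∧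
  ‖P.A‖ ≤ θ.Lxy

/-- The duality gap `sup_{y'} F(x,y') - inf_{x'} F(x',y)`. It is taken in the extended reals; the
supremum is never `⊥` and the infimum never `⊤`, so the difference is always meaningful. -/
noncomputable def BilinearProblem.dualityGap (P : BilinearProblem X Y) (x : X) (y : Y) : EReal :=
  (⨆ y' : Y, (P.value x y' : EReal)) - (⨅ x' : X, (P.value x' y : EReal))

/-- The problem in the changed variables `(U x, V y)`. -/
noncomputable def BilinearProblem.rotate (P : BilinearProblem X Y) (U : X →L[ℝ] X)
    (V : Y →L[ℝ] Y) : BilinearProblem X Y where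
  f := fun x => P.f (U x)
  A := (ContinuousLinearMap.adjoint U).comp (P.A.comp V)
  g := fun y => P.g (V y)

theorem BilinearProblem.value_rotate (P : BilinearProblem X Y) (U : X →L[ℝ] X)
    (V : Y →L[ℝ] Y) (x : X) (y : Y) :
    (P.rotate U V).value x y = P.value (U x) (V y) := by
  simp [BilinearProblem.value, BilinearProblem.rotate, ContinuousLinearMap.adjoint_inner_right]

/-- The proximal mapping `prox_{γ f}(v) = argmin_x f(x) + ‖x - v‖² / (2γ)` (a minimizer, which
exists and is unique for `γ > 0` and `f` lower semicontinuous and strongly convex on a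
finite-dimensional space). -/
noncomputable def prox (γ : ℝ) (f : X → ℝ) (v : X) : X :=
  Classical.epsilon fun p : X => IsMinOn (fun x => f x + 1 / (2 * γ) * ‖x - v‖ ^ 2) Set.univ p

/-- A deterministic algorithm of the general proximal class. In iteration `k ≥ 1` the `x`-block maps
receive `θ` and the history `(x⁰, A y⁰), …, (x^{k-1}, A y^{k-1})`, the `y`-block maps receive `θ` and
`(y⁰, Aᵀ x⁰), …, (y^{k-1}, Aᵀ x^{k-1})`. The maps `mapU`, `mapV` choose the prox centers, and `mapX`,
`mapY`, which also receive the answers of the proximal oracles, return the next iterate and the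
current output. The maps are arbitrary; their values at `k = 0` are never used. -/
structure ProxAlgorithm (X Y : Type*) where
  γ : ℕ → ClassParams → ℝ
  σ : ℕ → ClassParams → ℝ
  γ_pos : ∀ k θ, 0 < γ k θ
  σ_pos : ∀ k θ, 0 < σ k θ
  mapU : (k : ℕ) → ClassParams → (Fin k → X × X) → X
  mapV : (k : ℕ) → ClassParams → (Fin k → Y × Y) → Y
  mapX : (k : ℕ) → ClassParams → (Fin k → X × X) → X → X × X
  mapY : (k : ℕ) → ClassParams → (Fin k → Y × Y) → Y → Y × Y

/-- The iterate `(x, y)` and the output `(xOut, yOut)` of one iteration. -/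
structure RunState (X Y : Type*) where
  x : X
  xOut : X
  y : Y
  yOut : Y

variable [CompleteSpace Y]

/-- The run of the algorithm on the problem `P` from `(x⁰, y⁰)`. Before the first iteration the
output is the initial point. -/
noncomputable def ProxAlgorithm.run (𝒜 : ProxAlgorithm X Y) (θ : ClassParams)
    (P : BilinearProblem X Y) (x₀ : X) (y₀ : Y) : ℕ → RunState X Y
  | 0 => ⟨x₀, x₀, y₀, y₀⟩
  | k + 1 =>
    let histX : Fin (k + 1) → X × X := fun i =>
      ((𝒜.run θ P x₀ y₀ i).x, P.A (𝒜.run θ P x₀ y₀ i).y)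
    let histY : Fin (k + 1) → Y × Y := fun i =>
      ((𝒜.run θ P x₀ y₀ i).y, ContinuousLinearMap.adjoint P.A (𝒜.run θ P x₀ y₀ i).x)
    let u : X := 𝒜.mapU (k + 1) θ histX
    let v : Y := 𝒜.mapV (k + 1) θ histY
    let px : X × X := 𝒜.mapX (k + 1) θ histX (prox (𝒜.γ (k + 1) θ) P.f u)
    let py : Y × Y := 𝒜.mapY (k + 1) θ histY (prox (𝒜.σ (k + 1) θ) P.g v)
    ⟨px.1, px.2, py.1, py.2⟩
termination_by k => k
decreasing_by all_goals exact i.isLt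

end General

/-- `ℝⁿ` with the Euclidean norm. -/
abbrev Vec (n : ℕ) : Type := EuclideanSpace ℝ (Fin n)

/-- The linear operator `v ↦ M v` of a square matrix. -/
noncomputable abbrev op {n : ℕ} (M : Matrix (Fin n) (Fin n) ℝ) : Vec n →L[ℝ] Vec n :=
  Matrix.toEuclideanCLM (n := Fin n) (𝕜 := ℝ) M

/-- The matrix with `1` on the anti-diagonal (`i + j = n + 1` in one-based indices) and `-1` on the
anti-diagonal right below it (`i + j = n + 2`). -/
def chainMatrix (n : ℕ) : Matrix (Fin n) (Fin n) ℝ :=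
  Matrix.of fun i j =>
    if (i : ℕ) + (j : ℕ) + 1 = n then 1 else if (i : ℕ) + (j : ℕ) = n then -1 else 0

/-- `b = -(L_xy² / (4 μ_x)) e₁`. -/
noncomputable def bVec (θ : ClassParams) (n : ℕ) : Vec n :=
  WithLp.toLp 2 fun i => if (i : ℕ) = 0 then -(θ.Lxy ^ 2 / (4 * θ.μx)) else 0

/-- The instance `F(x,y) = μ_x/2 ‖x‖² + L_xy/2 xᵀ A y - μ_y/2 ‖y‖² - bᵀ y`. -/
noncomputable def worstCase (θ : ClassParams) (n : ℕ) : BilinearProblem (Vec n) (Vec n) where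
  f := fun x => θ.μx / 2 * ‖x‖ ^ 2
  A := (θ.Lxy / 2) • op (chainMatrix n)
  g := fun y => θ.μy / 2 * ‖y‖ ^ 2 + inner ℝ (bVec θ n) y

/-- `F_{U,V}(x,y) = F(U x, V y)`. -/
noncomputable def rotatedWorstCase (θ : ClassParams) {n : ℕ} (U V : Matrix (Fin n) (Fin n) ℝ) :
    BilinearProblem (Vec n) (Vec n) :=
  (worstCase θ n).rotate (op U) (op V)

/-- `H_x^k = Span {A^{2i} (A b) : 0 ≤ i ≤ ⌊k/2⌋ - 1}`, which is `{0}` for `k ≤ 1`. -/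
noncomputable def krylovX (θ : ClassParams) (n k : ℕ) : Submodule ℝ (Vec n) :=
  Submodule.span ℝ {v | ∃ i : ℕ, i < k / 2 ∧
    v = op (chainMatrix n ^ (2 * i)) (op (chainMatrix n) (bVec θ n))}

/-- `H_y^k = Span {A^{2i} b : 0 ≤ i ≤ ⌈k/2⌉ - 1}`. -/
noncomputable def krylovY (θ : ClassParams) (n k : ℕ) : Submodule ℝ (Vec n) :=
  Submodule.span ℝ {v | ∃ i : ℕ, i < (k + 1) / 2 ∧
    v = op (chainMatrix n ^ (2 * i)) (bVec θ n)}

/-- `q = 1 + 2 μ_x μ_y / L_xy² - 2 √((μ_x μ_y / L_xy²)² + μ_x μ_y / L_xy²)`. -/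
noncomputable def qRate (θ : ClassParams) : ℝ :=
  1 + 2 * (θ.μx * θ.μy / θ.Lxy ^ 2)
    - 2 * √((θ.μx * θ.μy / θ.Lxy ^ 2) ^ 2 + θ.μx * θ.μy / θ.Lxy ^ 2)

end SaddleProx

namespace SaddleProx

section Resisting

variable {X Y : Type*} [NormedAddCommGroup X] [InnerProductSpace ℝ X]
  [NormedAddCommGroup Y] [InnerProductSpace ℝ Y]

/-- An isometry can be modified off a subspace `W` so that a given vector lands in the image of any
subspace that contains `W` together with a unit vector orthogonal to `W`. -/
theorem exists_isometry_extend (P : X ≃ₗᵢ[ℝ] X) {W W' : Submodule ℝ X} [W.HasOrthogonalProjection]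
    (hW : W ≤ W') {a : X} (ha : ‖a‖ = 1) (haW : a ∈ Wᗮ) (haW' : a ∈ W') (w : X) :
    ∃ P' : X ≃ₗᵢ[ℝ] X, (∀ z ∈ W, P' z = P z) ∧ ∃ z ∈ W', P' z = w := by
  set p := W.starProjection (P.symm w) with hp
  have hpW : p ∈ W := W.starProjection_apply_mem _
  set d := P.symm w - p with hd
  have hdW : d ∈ Wᗮ := W.sub_starProjection_mem_orthogonal _
  set c := ‖d‖ • a with hc
  have hcd : ‖c‖ = ‖d‖ := by simp [hc, norm_smul, ha]
  set R := (Submodule.span ℝ {c - d})ᗮ.reflection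
  have hRW : ∀ z ∈ W, R z = z := by
    intro z hz
    refine Submodule.reflection_mem_subspace_eq_self ?_
    rw [Submodule.mem_orthogonal_singleton_iff_inner_left]
    exact (Wᗮ.sub_mem (Wᗮ.smul_mem _ haW) hdW) z hz
  have hRc : R c = d := Submodule.reflection_sub hcd
  refine ⟨R.trans P, fun z hz => by simp [hRW z hz], p + c, ?_, ?_⟩
  · exact W'.add_mem (hW hpW) (W'.smul_mem _ haW')
  · simp [hRW p hpW, hRc, hd, P.apply_symm_apply]

variable [CompleteSpace X]

/-- The problem in the variables `(P⁻¹ x, Q⁻¹ y)`. -/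
noncomputable abbrev BilinearProblem.rotateSymm (B : BilinearProblem X Y) (P : X ≃ₗᵢ[ℝ] X)
    (Q : Y ≃ₗᵢ[ℝ] Y) : BilinearProblem X Y :=
  B.rotate (P.symm.toContinuousLinearEquiv : X →L[ℝ] X) (Q.symm.toContinuousLinearEquiv : Y →L[ℝ] Y)

theorem adjoint_symm_apply (P : X ≃ₗᵢ[ℝ] X) (x : X) :
    ContinuousLinearMap.adjoint (P.symm.toContinuousLinearEquiv : X →L[ℝ] X) x = P x :=
  congrArg (fun T : X →L[ℝ] X => T x) P.symm.adjoint_eq_symm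

theorem BilinearProblem.rotateSymm_A (B : BilinearProblem X Y) (P : X ≃ₗᵢ[ℝ] X)
    (Q : Y ≃ₗᵢ[ℝ] Y) (y : Y) : (B.rotateSymm P Q).A (Q y) = P (B.A y) := by
  refine (adjoint_symm_apply P _).trans ?_
  simp

variable [CompleteSpace Y]

/-- Two problems with the same `f`, `g` whose coupling operators agree on the first iterates
produce the same run for one more iteration. -/
theorem ProxAlgorithm.run_congr (𝒜 : ProxAlgorithm X Y) (θ : ClassParams)
    {P P' : BilinearProblem X Y} (hf : P'.f = P.f) (hg : P'.g = P.g) (x₀ : X) (y₀ : Y) (k : ℕ)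
    (hA : ∀ i ≤ k, P'.A (𝒜.run θ P x₀ y₀ i).y = P.A (𝒜.run θ P x₀ y₀ i).y)
    (hA' : ∀ i ≤ k, ContinuousLinearMap.adjoint P'.A (𝒜.run θ P x₀ y₀ i).x =
      ContinuousLinearMap.adjoint P.A (𝒜.run θ P x₀ y₀ i).x) :
    ∀ i ≤ k + 1, 𝒜.run θ P' x₀ y₀ i = 𝒜.run θ P x₀ y₀ i := by
  intro i
  induction i using Nat.strong_induction_on with
  | _ i ih =>
    intro hi
    cases i with
    | zero => simp [ProxAlgorithm.run]
    | succ j =>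
      have hx : (fun i : Fin (j + 1) => ((𝒜.run θ P' x₀ y₀ i).x, P'.A (𝒜.run θ P' x₀ y₀ i).y)) =
          fun i : Fin (j + 1) => ((𝒜.run θ P x₀ y₀ i).x, P.A (𝒜.run θ P x₀ y₀ i).y) := by
        funext i
        rw [ih i i.isLt (by omega), hA i (by omega)]
      have hy : (fun i : Fin (j + 1) => ((𝒜.run θ P' x₀ y₀ i).y,
            ContinuousLinearMap.adjoint P'.A (𝒜.run θ P' x₀ y₀ i).x)) =
          fun i : Fin (j + 1) => ((𝒜.run θ P x₀ y₀ i).y,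
            ContinuousLinearMap.adjoint P.A (𝒜.run θ P x₀ y₀ i).x) := by
        funext i
        rw [ih i i.isLt (by omega), hA' i (by omega)]
      rw [ProxAlgorithm.run, ProxAlgorithm.run]
      simp only [hx, hy, hf, hg]

theorem BilinearProblem.rotateSymm_adjoint_A (B : BilinearProblem X Y) (P : X ≃ₗᵢ[ℝ] X)
    (Q : Y ≃ₗᵢ[ℝ] Y) (x : X) :
    ContinuousLinearMap.adjoint (B.rotateSymm P Q).A (P x) =
      Q (ContinuousLinearMap.adjoint B.A x) := by
  simp only [BilinearProblem.rotateSymm, BilinearProblem.rotate, ContinuousLinearMap.adjoint_comp,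
    ContinuousLinearMap.adjoint_adjoint, ContinuousLinearMap.comp_apply, adjoint_symm_apply]
  simp

/-- The resisting oracle: along filtrations `SX`, `SY` through which the coupling operator moves one
step at a time, coordinates can be chosen for any algorithm so that each iteration reveals only two
further members of each filtration. -/
theorem exists_resisting_isometries (𝒜 : ProxAlgorithm X Y) (θ : ClassParams)
    (B : BilinearProblem X Y) {SX : ℕ → Submodule ℝ X} {SY : ℕ → Submodule ℝ Y} {N : ℕ}
    [∀ j, (SX j).HasOrthogonalProjection] [∀ j, (SY j).HasOrthogonalProjection]
    (hSX : Monotone SX) (hSY : Monotone SY)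
    (hA : ∀ j, ∀ y ∈ SY j, B.A y ∈ SX j)
    (hA' : ∀ j, ∀ x ∈ SX j, ContinuousLinearMap.adjoint B.A x ∈ SY (j + 1))
    (hf : ∀ (R : X ≃ₗᵢ[ℝ] X) (x : X), B.f (R x) = B.f x)
    (hg : ∀ R R' : Y ≃ₗᵢ[ℝ] Y, (∀ z ∈ SY 1, R' z = R z) → ∀ y, B.g (R'.symm y) = B.g (R.symm y))
    (heX : ∀ j < N, ∃ a ∈ SX (j + 1), ‖a‖ = 1 ∧ a ∈ (SX j)ᗮ)
    (heY : ∀ j < N, ∃ a ∈ SY (j + 1), ‖a‖ = 1 ∧ a ∈ (SY j)ᗮ)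
    (k : ℕ) (hk : 2 * k + 1 ≤ N) :
    ∃ (P : X ≃ₗᵢ[ℝ] X) (Q : Y ≃ₗᵢ[ℝ] Y), ∀ i ≤ k,
      (∃ z ∈ SX (2 * i - 1), P z = (𝒜.run θ (B.rotateSymm P Q) 0 0 i).x) ∧
      (∃ z ∈ SY (2 * i), Q z = (𝒜.run θ (B.rotateSymm P Q) 0 0 i).y) ∧
      (∃ z ∈ SX (2 * i), P z = (𝒜.run θ (B.rotateSymm P Q) 0 0 i).xOut) ∧
      (∃ z ∈ SY (2 * i + 1), Q z = (𝒜.run θ (B.rotateSymm P Q) 0 0 i).yOut) := by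
  induction k with
  | zero =>
    refine ⟨.refl ℝ X, .refl ℝ Y, fun i hi => ?_⟩
    obtain rfl : i = 0 := by omega
    refine ⟨⟨0, zero_mem _, ?_⟩, ⟨0, zero_mem _, ?_⟩, ⟨0, zero_mem _, ?_⟩, ⟨0, zero_mem _, ?_⟩⟩ <;>
      simp [ProxAlgorithm.run]
  | succ k ih =>
    obtain ⟨P, Q, hPQ⟩ := ih (by omega)
    set r := 𝒜.run θ (B.rotateSymm P Q) 0 0 with hr
    obtain ⟨a₁, ha₁, na₁, oa₁⟩ := heX (2 * k) (by omega)
    obtain ⟨a₂, ha₂, na₂, oa₂⟩ := heX (2 * k + 1) (by omega)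
    obtain ⟨b₁, hb₁, nb₁, ob₁⟩ := heY (2 * k + 1) (by omega)
    obtain ⟨b₂, hb₂, nb₂, ob₂⟩ := heY (2 * k + 2) (by omega)
    obtain ⟨P₁, hP₁, x, hx, hx'⟩ :=
      exists_isometry_extend P (hSX (Nat.le_succ _)) na₁ oa₁ ha₁ (r (k + 1)).x
    obtain ⟨P₂, hP₂, xo, hxo, hxo'⟩ :=
      exists_isometry_extend P₁ (hSX (Nat.le_succ _)) na₂ oa₂ ha₂ (r (k + 1)).xOut
    obtain ⟨Q₁, hQ₁, y, hy, hy'⟩ :=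
      exists_isometry_extend Q (hSY (Nat.le_succ _)) nb₁ ob₁ hb₁ (r (k + 1)).y
    obtain ⟨Q₂, hQ₂, yo, hyo, hyo'⟩ :=
      exists_isometry_extend Q₁ (hSY (Nat.le_succ _)) nb₂ ob₂ hb₂ (r (k + 1)).yOut
    have hPP : ∀ z ∈ SX (2 * k), P₂ z = P z := fun z hz => by
      rw [hP₂ z (hSX (Nat.le_succ _) hz), hP₁ z hz]
    have hQQ : ∀ z ∈ SY (2 * k + 1), Q₂ z = Q z := fun z hz => by
      rw [hQ₂ z (hSY (Nat.le_succ _) hz), hQ₁ z hz]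
    have hrun : ∀ i ≤ k + 1, 𝒜.run θ (B.rotateSymm P₂ Q₂) 0 0 i = r i := by
      refine 𝒜.run_congr θ ?_ ?_ 0 0 k ?_ ?_
      · funext z
        exact (hf P₂.symm z).trans (hf P.symm z).symm
      · funext z
        exact hg Q Q₂ (fun w hw => hQQ w (hSY (by omega) hw)) z
      · intro i hi
        obtain ⟨-, ⟨z, hz, hz'⟩, -⟩ := hPQ i hi
        rw [← hr, ← hz', B.rotateSymm_A, ← hQQ z (hSY (by omega) hz), B.rotateSymm_A]
        exact hPP _ (hSX (by omega) (hA _ _ hz))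
      · intro i hi
        obtain ⟨⟨z, hz, hz'⟩, -⟩ := hPQ i hi
        rw [← hr, ← hz', B.rotateSymm_adjoint_A, ← hPP z (hSX (by omega) hz),
          B.rotateSymm_adjoint_A]
        exact hQQ _ (hSY (by omega) (hA' _ _ hz))
    refine ⟨P₂, Q₂, fun i hi => ?_⟩
    rw [hrun i hi]
    rcases Nat.lt_or_ge k i with hki | hki
    · obtain rfl : i = k + 1 := by omega
      refine ⟨⟨x, ?_, ?_⟩, ⟨y, ?_, ?_⟩, ⟨xo, hxo, hxo'⟩, ⟨yo, hyo, hyo'⟩⟩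
      · exact hSX (by omega) hx
      · rw [hP₂ x hx, hx']
      · exact hSY (by omega) hy
      · rw [hQ₂ y hy, hy']
    · obtain ⟨⟨z₁, hz₁, e₁⟩, ⟨z₂, hz₂, e₂⟩, ⟨z₃, hz₃, e₃⟩, ⟨z₄, hz₄, e₄⟩⟩ := hPQ i hki
      refine ⟨⟨z₁, hz₁, ?_⟩, ⟨z₂, hz₂, ?_⟩, ⟨z₃, hz₃, ?_⟩, ⟨z₄, hz₄, ?_⟩⟩
      · rw [hPP _ (hSX (by omega) hz₁), e₁]
      · rw [hQQ _ (hSY (by omega) hz₂), e₂]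
      · rw [hPP _ (hSX (by omega) hz₃), e₃]
      · rw [hQQ _ (hSY (by omega) hz₄), e₄]

end Resisting

section Chain

variable {n : ℕ}

/-- The coordinates of a vector, continued by zero. -/
noncomputable def coord (v : Vec n) (j : ℕ) : ℝ := if h : j < n then v ⟨j, h⟩ else 0

theorem coord_fin (v : Vec n) (i : Fin n) : coord v i = v i := by simp [coord]

theorem coord_of_le (v : Vec n) {j : ℕ} (h : n ≤ j) : coord v j = 0 := by
  simp [coord, Nat.not_lt.2 h]

theorem coord_eq_sum (v : Vec n) (j : ℕ) :
    coord v j = ∑ i : Fin n, if (i : ℕ) = j then v i else 0 := by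
  by_cases h : j < n
  · rw [Finset.sum_eq_single (⟨j, h⟩ : Fin n)]
    · simp [coord, h]
    · intro i _ hi
      rw [if_neg]
      exact fun e => hi (Fin.ext e)
    · simp
  · rw [coord_of_le v (by omega), Finset.sum_eq_zero]
    intro i _
    rw [if_neg]
    have := i.isLt
    omega

theorem op_chainMatrix_apply (v : Vec n) (i : Fin n) :
    op (chainMatrix n) v i = coord v (n - 1 - i) - coord v (n - i) := by
  have hi := i.isLt
  rw [coord_eq_sum, coord_eq_sum, ← Finset.sum_sub_distrib]
  change ∑ j, chainMatrix n i j * v j = _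
  refine Finset.sum_congr rfl fun j _ => ?_
  simp only [chainMatrix, Matrix.of_apply]
  have hj := j.isLt
  by_cases h1 : (j : ℕ) = n - 1 - i
  · rw [if_pos (by omega), if_pos h1, if_neg (by omega)]
    simp
  · by_cases h2 : (j : ℕ) = n - i
    · rw [if_neg (by omega), if_pos (by omega), if_neg h1, if_pos h2]
      simp
    · rw [if_neg (by omega), if_neg (by omega), if_neg h1, if_neg h2]
      simp

theorem coord_op_chainMatrix (v : Vec n) {j : ℕ} (hj : j < n) :
    coord (op (chainMatrix n) v) j = coord v (n - 1 - j) - coord v (n - j) := by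
  rw [← op_chainMatrix_apply v ⟨j, hj⟩]
  exact coord_fin _ (⟨j, hj⟩ : Fin n)

theorem coord_op_chainMatrix_sq_zero (v : Vec n) (hn : 0 < n) :
    coord (op (chainMatrix n) (op (chainMatrix n) v)) 0 = coord v 0 - coord v 1 := by
  rw [coord_op_chainMatrix _ hn, coord_of_le _ (by omega : n ≤ n - 0),
    coord_op_chainMatrix _ (by omega)]
  rw [show n - 1 - (n - 1 - 0) = 0 by omega, show n - (n - 1 - 0) = 1 by omega]
  ring

theorem coord_op_chainMatrix_sq_succ (v : Vec n) {j : ℕ} (hj : j + 1 < n) :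
    coord (op (chainMatrix n) (op (chainMatrix n) v)) (j + 1) =
      2 * coord v (j + 1) - coord v j - coord v (j + 2) := by
  rw [coord_op_chainMatrix _ hj, coord_op_chainMatrix _ (by omega),
    coord_op_chainMatrix _ (by omega)]
  rw [show n - 1 - (n - 1 - (j + 1)) = j + 1 by omega, show n - (n - 1 - (j + 1)) = j + 2 by omega,
    show n - 1 - (n - (j + 1)) = j by omega, show n - (n - (j + 1)) = j + 1 by omega]
  ring

theorem ext_coord {v w : Vec n} (h : ∀ j < n, coord v j = coord w j) : v = w := by
  ext i
  simpa [coord_fin] using h i i.isLt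

theorem norm_sq_eq_sum_coord (v : Vec n) : ‖v‖ ^ 2 = ∑ j ∈ Finset.range n, coord v j ^ 2 := by
  rw [EuclideanSpace.real_norm_sq_eq, ← Fin.sum_univ_eq_sum_range (fun j => coord v j ^ 2)]
  simp [coord_fin]

theorem chainMatrix_transpose : (chainMatrix n).transpose = chainMatrix n := by
  ext i j
  simp [chainMatrix, add_comm (i : ℕ) (j : ℕ)]

theorem adjoint_op (M : Matrix (Fin n) (Fin n) ℝ) :
    ContinuousLinearMap.adjoint (op M) = op M.transpose := by
  rw [← ContinuousLinearMap.star_eq_adjoint, ← map_star, Matrix.star_eq_conjTranspose,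
    Matrix.conjTranspose_eq_transpose_of_trivial]

theorem adjoint_op_chainMatrix :
    ContinuousLinearMap.adjoint (op (chainMatrix n)) = op (chainMatrix n) := by
  rw [adjoint_op, chainMatrix_transpose]

theorem norm_op_chainMatrix_le : ‖op (chainMatrix n)‖ ≤ 2 := by
  refine ContinuousLinearMap.opNorm_le_bound _ (by norm_num) fun v => ?_
  refine abs_le_of_sq_le_sq' ?_ (by positivity) |>.2
  rw [mul_pow, norm_sq_eq_sum_coord, norm_sq_eq_sum_coord]
  have h1 : ∑ j ∈ Finset.range n, coord v (n - 1 - j) ^ 2 = ∑ j ∈ Finset.range n, coord v j ^ 2 :=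
    Finset.sum_range_reflect (fun j => coord v j ^ 2) n
  have h2 : ∑ j ∈ Finset.range n, coord v (n - j) ^ 2 ≤ ∑ j ∈ Finset.range n, coord v j ^ 2 := by
    calc ∑ j ∈ Finset.range n, coord v (n - j) ^ 2
        = ∑ j ∈ Finset.range n, coord v (n - 1 - j + 1) ^ 2 := by
          refine Finset.sum_congr rfl fun j hj => ?_
          rw [Finset.mem_range] at hj
          rw [show n - 1 - j + 1 = n - j by omega]
      _ = ∑ j ∈ Finset.range n, coord v (j + 1) ^ 2 :=
          Finset.sum_range_reflect (fun j => coord v (j + 1) ^ 2) n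
      _ ≤ ∑ j ∈ Finset.range (n + 1), coord v j ^ 2 := by
          rw [Finset.sum_range_succ']
          linarith [sq_nonneg (coord v 0)]
      _ = ∑ j ∈ Finset.range n, coord v j ^ 2 := by
          rw [Finset.sum_range_succ, coord_of_le v le_rfl]
          ring
  calc ∑ j ∈ Finset.range n, coord (op (chainMatrix n) v) j ^ 2
      ≤ ∑ j ∈ Finset.range n, (2 * coord v (n - 1 - j) ^ 2 + 2 * coord v (n - j) ^ 2) := by
        refine Finset.sum_le_sum fun j hj => ?_
        rw [coord_op_chainMatrix v (Finset.mem_range.1 hj)]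
        nlinarith [sq_nonneg (coord v (n - 1 - j) + coord v (n - j))]
    _ ≤ 2 ^ 2 * ∑ j ∈ Finset.range n, coord v j ^ 2 := by
        rw [Finset.sum_add_distrib, ← Finset.mul_sum, ← Finset.mul_sum, h1]
        linarith

/-- The standard basis vector with index `j`, zero when `j` is out of range. -/
noncomputable def stdVec (n j : ℕ) : Vec n := WithLp.toLp 2 fun i => if (i : ℕ) = j then 1 else 0

theorem coord_stdVec {j : ℕ} (hj : j < n) (i : ℕ) :
    coord (stdVec n j) i = if i = j then 1 else 0 := by
  by_cases h : i < n
  · simp [coord, h, stdVec]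
  · rw [coord_of_le _ (by omega), if_neg (by omega)]

theorem norm_stdVec {j : ℕ} (hj : j < n) : ‖stdVec n j‖ = 1 := by
  have : ‖stdVec n j‖ ^ 2 = 1 := by
    rw [norm_sq_eq_sum_coord]
    simp [coord_stdVec hj, hj]
  nlinarith [norm_nonneg (stdVec n j)]

theorem inner_stdVec {j : ℕ} (v : Vec n) : inner ℝ v (stdVec n j) = coord v j := by
  rw [coord_eq_sum]
  simp [PiLp.inner_apply, stdVec]

theorem coord_add (v w : Vec n) (j : ℕ) : coord (v + w) j = coord v j + coord w j := by
  unfold coord; split <;> simp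

theorem coord_sub (v w : Vec n) (j : ℕ) : coord (v - w) j = coord v j - coord w j := by
  unfold coord; split <;> simp

theorem coord_smul (c : ℝ) (v : Vec n) (j : ℕ) : coord (c • v) j = c * coord v j := by
  unfold coord; split <;> simp

theorem coord_zero (j : ℕ) : coord (0 : Vec n) j = 0 := by
  unfold coord; split <;> simp

/-- Vectors supported on the coordinates in `S`. -/
noncomputable def supportedOn (n : ℕ) (S : Set ℕ) : Submodule ℝ (Vec n) where
  carrier := {v | ∀ j ∉ S, coord v j = 0}
  add_mem' := fun ha hb j hj => by rw [coord_add, ha j hj, hb j hj, add_zero]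
  zero_mem' := fun j _ => coord_zero j
  smul_mem' := fun c v hv j hj => by rw [coord_smul, hv j hj, mul_zero]

theorem bVec_eq (θ : ClassParams) : bVec θ n = -(θ.Lxy ^ 2 / (4 * θ.μx)) • stdVec n 0 := by
  ext i
  by_cases h : (i : ℕ) = 0 <;> simp [bVec, stdVec, h]

theorem op_pow_succ_apply (M : Matrix (Fin n) (Fin n) ℝ) (i : ℕ) (v : Vec n) :
    op (M ^ (i + 1)) v = op M (op (M ^ i) v) := by
  rw [pow_succ', op, op, op, map_mul]
  rfl

theorem op_pow_comm_apply (M : Matrix (Fin n) (Fin n) ℝ) (i : ℕ) (v : Vec n) :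
    op (M ^ i) (op M v) = op M (op (M ^ i) v) := by
  rw [← op_pow_succ_apply, pow_succ, op, op, op, map_mul]
  rfl

variable (θ : ClassParams)

theorem krylovX_mono : Monotone (krylovX θ n) := fun _ _ h =>
  Submodule.span_mono fun _ ⟨i, hi, hv⟩ => ⟨i, hi.trans_le (Nat.div_le_div_right h), hv⟩

theorem krylovY_mono : Monotone (krylovY θ n) := fun _ _ h =>
  Submodule.span_mono fun _ ⟨i, hi, hv⟩ =>
    ⟨i, hi.trans_le (Nat.div_le_div_right (Nat.add_le_add_right h 1)), hv⟩

theorem op_chainMatrix_mem_krylovX {j : ℕ} {v : Vec n} (hv : v ∈ krylovY θ n (2 * j)) :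
    op (chainMatrix n) v ∈ krylovX θ n (2 * j) := by
  suffices h : krylovY θ n (2 * j) ≤
      (krylovX θ n (2 * j)).comap (op (chainMatrix n)).toLinearMap from h hv
  refine Submodule.span_le.2 ?_
  rintro _ ⟨i, hi, rfl⟩
  exact Submodule.subset_span ⟨i, by omega, (op_pow_comm_apply _ _ _).symm⟩

theorem op_chainMatrix_mem_krylovY {j : ℕ} {v : Vec n} (hv : v ∈ krylovX θ n (2 * j)) :
    op (chainMatrix n) v ∈ krylovY θ n (2 * (j + 1)) := by
  suffices h : krylovX θ n (2 * j) ≤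
      (krylovY θ n (2 * (j + 1))).comap (op (chainMatrix n)).toLinearMap from h hv
  refine Submodule.span_le.2 ?_
  rintro _ ⟨i, hi, rfl⟩
  refine Submodule.subset_span ⟨i + 1, by omega, ?_⟩
  change op (chainMatrix n) _ = _
  rw [mul_add, mul_one, op_pow_succ_apply, op_pow_succ_apply, op_pow_comm_apply]

theorem coord_eq_zero_of_mem_krylovY {j : ℕ} {v : Vec n} (hv : v ∈ krylovY θ n (2 * j)) {l : ℕ}
    (hl : j ≤ l) : coord v l = 0 := by
  have key : ∀ i l : ℕ, i < l → coord (op (chainMatrix n ^ (2 * i)) (bVec θ n)) l = 0 := by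
    intro i
    induction i with
    | zero =>
      intro l hl
      rcases Nat.lt_or_ge l n with h | h
      · rw [mul_zero, pow_zero, op, map_one, one_apply_eq_self, bVec_eq, coord_smul,
          coord_stdVec (by omega), if_neg hl.ne', mul_zero]
      · exact coord_of_le _ h
    | succ i ih =>
      intro l hl
      rcases Nat.lt_or_ge l n with h | h
      · obtain ⟨l, rfl⟩ : ∃ m, l = m + 1 := ⟨l - 1, by omega⟩
        rw [mul_add, mul_one, op_pow_succ_apply, op_pow_succ_apply, coord_op_chainMatrix_sq_succ _ h,
          ih _ (by omega), ih _ (by omega), ih _ (by omega)]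
        ring
      · exact coord_of_le _ h
  suffices h : krylovY θ n (2 * j) ≤ supportedOn n {l | l < j} from h hv l (by simpa using hl)
  refine Submodule.span_le.2 ?_
  rintro _ ⟨i, hi, rfl⟩ l hl
  simp only [Set.mem_ofPred_eq, not_lt] at hl
  exact key i l (by omega)

theorem coord_eq_zero_of_mem_krylovX {j : ℕ} {v : Vec n} (hv : v ∈ krylovX θ n (2 * j)) {l : ℕ}
    (hl : l + j < n) : coord v l = 0 := by
  suffices h : krylovX θ n (2 * j) ≤ supportedOn n {l | n ≤ l + j} from
    h hv l (by simpa using hl)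
  refine Submodule.span_le.2 ?_
  rintro _ ⟨i, hi, rfl⟩ l hl
  simp only [Set.mem_ofPred_eq, not_le] at hl
  have hm : op (chainMatrix n ^ (2 * i)) (bVec θ n) ∈ krylovY θ n (2 * j) :=
    Submodule.subset_span ⟨i, by omega, rfl⟩
  rw [op_pow_comm_apply, coord_op_chainMatrix _ (by omega),
    coord_eq_zero_of_mem_krylovY θ hm (by omega), coord_eq_zero_of_mem_krylovY θ hm (by omega),
    sub_zero]

variable {θ}

theorem stdVec_mem_krylovY (hL : 0 < θ.Lxy) (hx : 0 < θ.μx) {j : ℕ} (hj : j < n) :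
    stdVec n j ∈ krylovY θ n (2 * (j + 1)) := by
  induction j using Nat.strong_induction_on with
  | _ j ih =>
    match j with
    | 0 =>
      have hb : bVec θ n ∈ krylovY θ n (2 * (0 + 1)) :=
        Submodule.subset_span ⟨0, by norm_num, by simp⟩
      rw [bVec_eq] at hb
      refine (Submodule.smul_mem_iff _ ?_).1 hb
      have : 0 < θ.Lxy ^ 2 / (4 * θ.μx) := by positivity
      linarith
    | 1 =>
      have h0 := ih 0 (by omega) (by omega)
      have h1 := op_chainMatrix_mem_krylovY θ (op_chainMatrix_mem_krylovX θ h0)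
      have e : stdVec n 1 = stdVec n 0 - op (chainMatrix n) (op (chainMatrix n) (stdVec n 0)) := by
        refine ext_coord fun l hl => ?_
        rw [coord_sub]
        match l with
        | 0 =>
          rw [coord_op_chainMatrix_sq_zero _ (by omega)]
          simp [coord_stdVec hj, coord_stdVec (by omega : 0 < n)]
        | l + 1 =>
          rw [coord_op_chainMatrix_sq_succ _ hl]
          simp [coord_stdVec hj, coord_stdVec (by omega : 0 < n)]
      rw [e]
      exact Submodule.sub_mem _ (krylovY_mono θ (by omega) h0) h1
    | j + 2 =>
      have h0 := ih j (by omega) (by omega)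
      have h1 := ih (j + 1) (by omega) (by omega)
      have h2 := op_chainMatrix_mem_krylovY θ (op_chainMatrix_mem_krylovX θ h1)
      have e : stdVec n (j + 2) = (2 : ℝ) • stdVec n (j + 1) - stdVec n j -
          op (chainMatrix n) (op (chainMatrix n) (stdVec n (j + 1))) := by
        refine ext_coord fun l hl => ?_
        rw [coord_sub, coord_sub, coord_smul]
        match l with
        | 0 =>
          rw [coord_op_chainMatrix_sq_zero _ (by omega)]
          rw [coord_stdVec hj, coord_stdVec (by omega), coord_stdVec (by omega),
            coord_stdVec (by omega)]
          grind
        | l + 1 =>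
          rw [coord_op_chainMatrix_sq_succ _ hl]
          simp only [coord_stdVec hj, coord_stdVec (by omega : j < n),
            coord_stdVec (by omega : j + 1 < n)]
          grind
      rw [e]
      exact Submodule.sub_mem _ (Submodule.sub_mem _
        (Submodule.smul_mem _ _ (krylovY_mono θ (by omega) h1)) (krylovY_mono θ (by omega) h0)) h2

theorem stdVec_mem_krylovX (hL : 0 < θ.Lxy) (hx : 0 < θ.μx) {j : ℕ} (hj : j < n) :
    stdVec n (n - 1 - j) ∈ krylovX θ n (2 * (j + 1)) := by
  induction j with
  | zero =>
    have h := op_chainMatrix_mem_krylovX θ (stdVec_mem_krylovY hL hx hj)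
    have e : op (chainMatrix n) (stdVec n 0) = stdVec n (n - 1 - 0) := by
      refine ext_coord fun l hl => ?_
      rw [coord_op_chainMatrix _ hl]
      simp only [coord_stdVec hj, coord_stdVec (by omega : n - 1 - 0 < n)]
      grind
    rwa [e] at h
  | succ j ih =>
    have h := op_chainMatrix_mem_krylovX θ (stdVec_mem_krylovY hL hx hj)
    have e : stdVec n (n - 1 - (j + 1)) =
        op (chainMatrix n) (stdVec n (j + 1)) + stdVec n (n - 1 - j) := by
      refine ext_coord fun l hl => ?_
      rw [coord_add, coord_op_chainMatrix _ hl]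
      simp only [coord_stdVec hj, coord_stdVec (by omega : n - 1 - j < n),
        coord_stdVec (by omega : n - 1 - (j + 1) < n)]
      grind
    rw [e]
    exact Submodule.add_mem _ h (krylovX_mono θ (by omega) (ih (by omega)))

end Chain

section Rate

/-- The ratio `μ_x μ_y / L_xy²`. -/
noncomputable abbrev condInv (θ : ClassParams) : ℝ := θ.μx * θ.μy / θ.Lxy ^ 2

theorem qRate_eq_exp {θ : ClassParams} (ha : 0 ≤ condInv θ) :
    qRate θ = Real.exp (-(2 * Real.arsinh (√(condInv θ)))) := by
  set a := condInv θ
  have h1 : √a ^ 2 = a := Real.sq_sqrt ha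
  have h2 : √(1 + a) ^ 2 = 1 + a := Real.sq_sqrt (by linarith)
  have h3 : √(a ^ 2 + a) = √a * √(1 + a) := by
    rw [← Real.sqrt_mul ha]; congr 1; ring
  have hq : qRate θ = (√(1 + a) - √a) ^ 2 := by
    change 1 + 2 * a - 2 * √(a ^ 2 + a) = _
    rw [h3]; nlinarith
  rw [hq, show -(2 * Real.arsinh √a) = ((2 : ℕ) : ℝ) * Real.arsinh (-√a) by
    rw [Real.arsinh_neg]; push_cast; ring, Real.exp_nat_mul, Real.exp_arsinh, neg_sq, h1]
  ring

theorem qRate_pos {θ : ClassParams} (ha : 0 ≤ condInv θ) : 0 < qRate θ := by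
  rw [qRate_eq_exp ha]; exact Real.exp_pos _

theorem qRate_lt_one {θ : ClassParams} (ha : 0 < condInv θ) : qRate θ < 1 := by
  rw [qRate_eq_exp ha.le, Real.exp_lt_one_iff]
  have := Real.arsinh_pos_iff.2 (Real.sqrt_pos.2 ha)
  linarith

theorem neg_log_qRate_le {θ : ClassParams} (ha : 0 ≤ condInv θ) :
    -Real.log (qRate θ) ≤ 2 * √(condInv θ) := by
  rw [qRate_eq_exp ha, Real.log_exp]
  have h : Real.arsinh √(condInv θ) ≤ √(condInv θ) := by
    rw [← Real.sinh_le_sinh, Real.sinh_arsinh]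
    exact Real.self_le_sinh_iff.2 (Real.sqrt_nonneg _)
  linarith

theorem qRate_quadratic {θ : ClassParams} (ha : 0 ≤ condInv θ) :
    qRate θ ^ 2 = (2 + 4 * condInv θ) * qRate θ - 1 := by
  have h : √(condInv θ ^ 2 + condInv θ) ^ 2 = condInv θ ^ 2 + condInv θ :=
    Real.sq_sqrt (by positivity)
  change (1 + 2 * condInv θ - 2 * √(condInv θ ^ 2 + condInv θ)) ^ 2 =
    (2 + 4 * condInv θ) * (1 + 2 * condInv θ - 2 * √(condInv θ ^ 2 + condInv θ)) - 1
  linear_combination 4 * h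

/-- The tail of the sequence `q^{j+1} - q^{2n+1-j}` carries a fixed proportion of `q^{2m}` times its
total mass. -/
theorem sum_tail_lower_bound {q : ℝ} (hq0 : 0 < q) (hq1 : q < 1) {m s n : ℕ}
    (hs : q ^ (2 * s) ≤ 1 / 2) (hn : m + 2 * s ≤ n) :
    q ^ (2 * m) / 16 * ∑ j ∈ Finset.range n, (q ^ (j + 1) - q ^ (2 * n + 1 - j)) ^ 2 ≤
      ∑ j ∈ Finset.Ico m n, (q ^ (j + 1) - q ^ (2 * n + 1 - j)) ^ 2 := by
  set r := q ^ 2 with hr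
  have hr1 : r < 1 := by rw [hr]; nlinarith
  have hr0 : 0 < r := by positivity
  have hgeom : ∀ l : ℕ, (1 - r) * ∑ j ∈ Finset.range l, r ^ (j + 1) = r * (1 - r ^ l) := by
    intro l
    have h := mul_neg_geom_sum r l
    have : ∑ j ∈ Finset.range l, r ^ (j + 1) = r * ∑ j ∈ Finset.range l, r ^ j := by
      rw [Finset.mul_sum]
      exact Finset.sum_congr rfl fun j _ => pow_succ' r j
    rw [this]
    linear_combination r * h
  have hrs : r ^ s ≤ 1 / 2 := by rwa [hr, ← pow_mul]
  have htotal : ∑ j ∈ Finset.range n, (q ^ (j + 1) - q ^ (2 * n + 1 - j)) ^ 2 ≤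
      2 * ∑ j ∈ Finset.range s, r ^ (j + 1) := by
    have h1 : ∑ j ∈ Finset.range n, (q ^ (j + 1) - q ^ (2 * n + 1 - j)) ^ 2 ≤
        ∑ j ∈ Finset.range n, r ^ (j + 1) := by
      refine Finset.sum_le_sum fun j hj => ?_
      rw [Finset.mem_range] at hj
      have ha : q ^ (2 * n + 1 - j) ≤ q ^ (j + 1) :=
        pow_le_pow_of_le_one hq0.le hq1.le (by omega)
      have hb : 0 < q ^ (2 * n + 1 - j) := by positivity
      rw [show r ^ (j + 1) = (q ^ (j + 1)) ^ 2 by rw [hr]; ring]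
      exact pow_le_pow_left₀ (by linarith) (by linarith) 2
    have h2 : (1 - r) * ∑ j ∈ Finset.range n, r ^ (j + 1) ≤
        (1 - r) * (2 * ∑ j ∈ Finset.range s, r ^ (j + 1)) := by
      have h3 := hgeom n
      have h4 := hgeom s
      have h5 : 0 < r ^ n := by positivity
      nlinarith
    exact h1.trans (le_of_mul_le_mul_left h2 (by linarith))
  have htail : q ^ (2 * m) / 4 * ∑ j ∈ Finset.range s, r ^ (j + 1) ≤
      ∑ j ∈ Finset.Ico m n, (q ^ (j + 1) - q ^ (2 * n + 1 - j)) ^ 2 := by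
    calc q ^ (2 * m) / 4 * ∑ j ∈ Finset.range s, r ^ (j + 1)
        ≤ ∑ j ∈ Finset.range s, (q ^ (m + j + 1) - q ^ (2 * n + 1 - (m + j))) ^ 2 := by
          rw [Finset.mul_sum]
          refine Finset.sum_le_sum fun j hj => ?_
          rw [Finset.mem_range] at hj
          have ha : q ^ (2 * n + 1 - (m + j)) ≤ q ^ (m + j + 1) * q ^ (2 * s) := by
            rw [← pow_add]
            exact pow_le_pow_of_le_one hq0.le hq1.le (by omega)
          have hb : 0 < q ^ (m + j + 1) := by positivity
          have hc : q ^ (m + j + 1) / 2 ≤ q ^ (m + j + 1) - q ^ (2 * n + 1 - (m + j)) := by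
            nlinarith
          have hd : q ^ (2 * m) / 4 * r ^ (j + 1) = (q ^ (m + j + 1) / 2) ^ 2 := by
            rw [hr]; ring
          rw [hd]
          exact pow_le_pow_left₀ (by positivity) hc 2
      _ ≤ ∑ j ∈ Finset.range (n - m), (q ^ (m + j + 1) - q ^ (2 * n + 1 - (m + j))) ^ 2 :=
          Finset.sum_le_sum_of_subset_of_nonneg (Finset.range_subset_range.2 (by omega))
            fun _ _ _ => sq_nonneg _
      _ = _ := (Finset.sum_Ico_eq_sum_range
          (fun j => (q ^ (j + 1) - q ^ (2 * n + 1 - j)) ^ 2) m n).symm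
  have hm : 0 < q ^ (2 * m) := by positivity
  have h0 : 0 ≤ ∑ j ∈ Finset.range s, r ^ (j + 1) := Finset.sum_nonneg fun _ _ => by positivity
  nlinarith [mul_le_mul_of_nonneg_left htotal hm.le, mul_nonneg hm.le h0]

end Rate

section Saddle

variable {n : ℕ}

/-- The `y`-part of the saddle point of `worstCase`. -/
noncomputable def saddleY (θ : ClassParams) (n : ℕ) : Vec n :=
  WithLp.toLp 2 fun j => 1 / ((1 - qRate θ) * (1 + qRate θ ^ (2 * n + 1))) *
    (qRate θ ^ ((j : ℕ) + 1) - qRate θ ^ (2 * n + 1 - (j : ℕ)))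

/-- The `x`-part of the saddle point of `worstCase`. -/
noncomputable def saddleX (θ : ClassParams) (n : ℕ) : Vec n :=
  (-(θ.Lxy / (2 * θ.μx))) • op (chainMatrix n) (saddleY θ n)

theorem coord_saddleY (θ : ClassParams) {j : ℕ} (hj : j ≤ n) :
    coord (saddleY θ n) j = 1 / ((1 - qRate θ) * (1 + qRate θ ^ (2 * n + 1))) *
      (qRate θ ^ (j + 1) - qRate θ ^ (2 * n + 1 - j)) := by
  rcases hj.lt_or_eq with h | rfl
  · simp [coord, h, saddleY]
  · rw [coord_of_le _ le_rfl, show 2 * j + 1 - j = j + 1 by omega]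
    ring

variable {θ : ClassParams}

theorem condInv_pos (hL : 0 < θ.Lxy) (hx : 0 < θ.μx) (hy : 0 < θ.μy) : 0 < condInv θ := by
  unfold condInv; positivity

theorem op_chainMatrix_sq_saddleY (ha : 0 < condInv θ) (hn : 0 < n) :
    op (chainMatrix n) (op (chainMatrix n) (saddleY θ n)) + (4 * condInv θ) • saddleY θ n =
      stdVec n 0 := by
  have hq0 := qRate_pos ha.le
  have hq1 := qRate_lt_one ha
  have hqq := qRate_quadratic ha.le
  refine ext_coord fun j hj => ?_
  rw [coord_add, coord_smul, coord_stdVec hn]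
  have hp : 0 < qRate θ ^ (2 * n + 1) := by positivity
  match j with
  | 0 =>
    rw [coord_op_chainMatrix_sq_zero _ hn, coord_saddleY θ (by omega), coord_saddleY θ (by omega)]
    have e : qRate θ ^ (2 * n + 1 - 0) = qRate θ * qRate θ ^ (2 * n + 1 - 1) := by
      rw [← pow_succ']; rfl
    have e' : qRate θ ^ (2 * n + 1) = qRate θ * qRate θ ^ (2 * n + 1 - 1) := by
      rw [← pow_succ']; congr 1
    rw [if_pos rfl]
    rw [e'] at hp ⊢
    rw [e]
    have h1 : 1 - qRate θ ≠ 0 := by linarith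
    have h2 : 1 + qRate θ * qRate θ ^ (2 * n + 1 - 1) ≠ 0 := by linarith
    field_simp
    linear_combination (qRate θ ^ (2 * n + 1 - 1) - 1) * hqq
  | j + 1 =>
    rw [coord_op_chainMatrix_sq_succ _ hj, coord_saddleY θ (by omega), coord_saddleY θ (by omega),
      coord_saddleY θ (by omega), if_neg (by omega)]
    have e1 : qRate θ ^ (2 * n + 1 - (j + 1)) = qRate θ * qRate θ ^ (2 * n + 1 - (j + 2)) := by
      rw [← pow_succ']; congr 1; omega
    have e2 : qRate θ ^ (2 * n + 1 - j) = qRate θ ^ 2 * qRate θ ^ (2 * n + 1 - (j + 2)) := by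
      rw [← pow_add]; congr 1; omega
    rw [e1, e2]
    linear_combination (1 / ((1 - qRate θ) * (1 + qRate θ ^ (2 * n + 1)))) *
      (qRate θ ^ (2 * n + 1 - (j + 2)) - qRate θ ^ (j + 1)) * hqq

/-- Both variables of `worstCase` enjoy exact quadratic growth around the saddle point. -/
theorem value_sub_value_saddle (hL : 0 < θ.Lxy) (hx : 0 < θ.μx) (hy : 0 < θ.μy) (hn : 0 < n)
    (x y : Vec n) :
    (worstCase θ n).value x (saddleY θ n) - (worstCase θ n).value (saddleX θ n) y =
      θ.μx / 2 * ‖x - saddleX θ n‖ ^ 2 + θ.μy / 2 * ‖y - saddleY θ n‖ ^ 2 := by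
  have hA := op_chainMatrix_sq_saddleY (condInv_pos hL hx hy) hn
  set A := op (chainMatrix n)
  set xs := saddleX θ n with hxs
  set ys := saddleY θ n
  have h1 : (θ.Lxy / 2) • A ys = -(θ.μx • xs) := by
    rw [hxs, saddleX, smul_smul, ← neg_smul]
    congr 1
    field_simp
  have h2 : (θ.Lxy / 2) • A xs = θ.μy • ys + bVec θ n := by
    rw [bVec_eq, ← hA, hxs, saddleX, map_smul, smul_smul, smul_add, smul_smul]
    have e1 : θ.Lxy / 2 * -(θ.Lxy / (2 * θ.μx)) = -(θ.Lxy ^ 2 / (4 * θ.μx)) := by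
      field_simp; ring
    have e2 : -(θ.Lxy ^ 2 / (4 * θ.μx)) * (4 * condInv θ) = -θ.μy := by
      unfold condInv; field_simp
    rw [e1, e2, neg_smul θ.μy]
    abel
  have hsymm : ∀ z : Vec n, inner ℝ xs ((θ.Lxy / 2) • A z) = inner ℝ ((θ.Lxy / 2) • A xs) z := by
    intro z
    rw [inner_smul_left, inner_smul_right, ← ContinuousLinearMap.adjoint_inner_left,
      adjoint_op_chainMatrix]
    rfl
  have h3 : inner ℝ xs ((θ.Lxy / 2) • A y) = θ.μy * inner ℝ ys y + inner ℝ (bVec θ n) y := by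
    rw [hsymm, h2, inner_add_left, inner_smul_left]; rfl
  have h4 : -(θ.μx * ‖xs‖ ^ 2) = θ.μy * ‖ys‖ ^ 2 + inner ℝ (bVec θ n) ys := by
    have := hsymm ys
    rw [h1, h2, inner_neg_right, inner_smul_right, inner_add_left, inner_smul_left,
      real_inner_self_eq_norm_sq, real_inner_self_eq_norm_sq] at this
    exact this
  have h5 : inner ℝ x ((θ.Lxy / 2) • A ys) = -(θ.μx * inner ℝ x xs) := by
    rw [h1, inner_neg_right, inner_smul_right]
  change (θ.μx / 2 * ‖x‖ ^ 2 + inner ℝ x ((θ.Lxy / 2) • A ys) -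
    (θ.μy / 2 * ‖ys‖ ^ 2 + inner ℝ (bVec θ n) ys)) - (θ.μx / 2 * ‖xs‖ ^ 2 +
    inner ℝ xs ((θ.Lxy / 2) • A y) - (θ.μy / 2 * ‖y‖ ^ 2 + inner ℝ (bVec θ n) y)) = _
  rw [h3, h5, norm_sub_sq_real, norm_sub_sq_real, real_inner_comm ys y]
  linear_combination h4

theorem isSaddlePointOn_worstCase_iff (hL : 0 < θ.Lxy) (hx : 0 < θ.μx) (hy : 0 < θ.μy)
    (hn : 0 < n) (x y : Vec n) :
    IsSaddlePointOn Set.univ Set.univ (worstCase θ n).value x y ↔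
      x = saddleX θ n ∧ y = saddleY θ n := by
  constructor
  · intro h
    have h1 := h (saddleX θ n) (Set.mem_univ _) (saddleY θ n) (Set.mem_univ _)
    have h2 := value_sub_value_saddle hL hx hy hn x y
    have h3 : 0 ≤ θ.μx / 2 * ‖x - saddleX θ n‖ ^ 2 := by positivity
    have h4 : 0 ≤ θ.μy / 2 * ‖y - saddleY θ n‖ ^ 2 := by positivity
    have h5 : θ.μx / 2 * ‖x - saddleX θ n‖ ^ 2 = 0 := by linarith
    have h6 : θ.μy / 2 * ‖y - saddleY θ n‖ ^ 2 = 0 := by linarith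
    simpa [hx.ne', hy.ne', sub_eq_zero] using And.intro h5 h6
  · rintro ⟨rfl, rfl⟩ x' _ y' _
    have h2 := value_sub_value_saddle hL hx hy hn x' y'
    have h3 : 0 ≤ θ.μx / 2 * ‖x' - saddleX θ n‖ ^ 2 := by positivity
    have h4 : 0 ≤ θ.μy / 2 * ‖y' - saddleY θ n‖ ^ 2 := by positivity
    linarith

theorem norm_sub_saddleY_lower_bound (ha : 0 < condInv θ) {m s : ℕ}
    (hs : qRate θ ^ (2 * s) ≤ 1 / 2) (hn : m + 2 * s ≤ n) {y : Vec n}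
    (hy : y ∈ krylovY θ n (2 * m)) :
    qRate θ ^ (2 * m) / 16 * ‖saddleY θ n‖ ^ 2 ≤ ‖y - saddleY θ n‖ ^ 2 := by
  set c := 1 / ((1 - qRate θ) * (1 + qRate θ ^ (2 * n + 1)))
  have h := sum_tail_lower_bound (qRate_pos ha.le) (qRate_lt_one ha) hs hn
  have e : ‖saddleY θ n‖ ^ 2 = c ^ 2 *
      ∑ j ∈ Finset.range n, (qRate θ ^ (j + 1) - qRate θ ^ (2 * n + 1 - j)) ^ 2 := by
    rw [norm_sq_eq_sum_coord, Finset.mul_sum]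
    refine Finset.sum_congr rfl fun j hj => ?_
    rw [coord_saddleY θ (Finset.mem_range.1 hj).le, mul_pow]
  have e' : c ^ 2 * ∑ j ∈ Finset.Ico m n, (qRate θ ^ (j + 1) - qRate θ ^ (2 * n + 1 - j)) ^ 2 ≤
      ‖y - saddleY θ n‖ ^ 2 := by
    rw [norm_sq_eq_sum_coord, Finset.mul_sum]
    calc _ = ∑ j ∈ Finset.Ico m n, coord (y - saddleY θ n) j ^ 2 := by
          refine Finset.sum_congr rfl fun j hj => ?_
          rw [Finset.mem_Ico] at hj
          rw [coord_sub, coord_eq_zero_of_mem_krylovY θ hy hj.1, coord_saddleY θ hj.2.le, zero_sub,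
            neg_sq, mul_pow]
      _ ≤ _ := Finset.sum_le_sum_of_subset_of_nonneg
          (fun j hj => Finset.mem_range.2 (Finset.mem_Ico.1 hj).2) fun _ _ _ => sq_nonneg _
  refine le_trans ?_ e'
  rw [e]
  nlinarith [mul_le_mul_of_nonneg_left h (sq_nonneg c)]

theorem norm_saddleY_lower_bound (ha : 0 < condInv θ) (hn : 0 < n) :
    qRate θ / 2 ≤ ‖saddleY θ n‖ := by
  have hq0 := qRate_pos ha.le
  have hq1 := qRate_lt_one ha
  set q := qRate θ
  have h1 : coord (saddleY θ n) 0 ≤ ‖saddleY θ n‖ := by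
    refine (le_abs_self _).trans ?_
    have h := coord_fin (saddleY θ n) ⟨0, hn⟩
    rw [h, ← Real.norm_eq_abs]
    exact PiLp.norm_apply_le _ _
  refine le_trans ?_ h1
  rw [coord_saddleY θ (by omega)]
  have h2 : q ^ (2 * n + 1) ≤ q * q := by
    rw [← sq]; exact pow_le_pow_of_le_one hq0.le hq1.le (by omega)
  have h3 : q ^ (2 * n + 1) ≤ 1 := pow_le_one₀ hq0.le hq1.le
  have h4 : 0 < q ^ (2 * n + 1) := by positivity
  rw [one_div_mul_eq_div, le_div_iff₀ (mul_pos (by linarith) (by linarith)), Nat.sub_zero, zero_add,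
    pow_one]
  nlinarith [mul_pos hq0 (sub_pos.2 hq1)]

end Saddle

section Rotation

variable {n : ℕ} {θ : ClassParams}

theorem op_transpose_op {U : Matrix (Fin n) (Fin n) ℝ} (hU : U ∈ Matrix.orthogonalGroup (Fin n) ℝ)
    (x : Vec n) : op U.transpose (op U x) = x := by
  have h : op (U.transpose * U) x = x := by
    have := (Matrix.mem_orthogonalGroup_iff' _ _).1 hU
    simp [this]
  rwa [op, map_mul] at h

theorem op_op_transpose {U : Matrix (Fin n) (Fin n) ℝ} (hU : U ∈ Matrix.orthogonalGroup (Fin n) ℝ)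
    (x : Vec n) : op U (op U.transpose x) = x := by
  have h : op (U * U.transpose) x = x := by
    have := (Matrix.mem_orthogonalGroup_iff _ _).1 hU
    simp [this]
  rwa [op, map_mul] at h

theorem norm_op {U : Matrix (Fin n) (Fin n) ℝ} (hU : U ∈ Matrix.orthogonalGroup (Fin n) ℝ)
    (x : Vec n) : ‖op U x‖ = ‖x‖ := by
  have h : inner ℝ (op U x) (op U x) = inner ℝ x x := by
    rw [← ContinuousLinearMap.adjoint_inner_right, adjoint_op, op_transpose_op hU]
  rw [real_inner_self_eq_norm_sq, real_inner_self_eq_norm_sq] at h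
  exact (sq_eq_sq₀ (norm_nonneg _) (norm_nonneg _)).1 h

theorem exists_orthogonal_op_eq (P : Vec n ≃ₗᵢ[ℝ] Vec n) :
    ∃ U ∈ Matrix.orthogonalGroup (Fin n) ℝ,
      op U = (P.symm.toContinuousLinearEquiv : Vec n →L[ℝ] Vec n) ∧
      ∀ x, op U.transpose x = P x := by
  set U := (Matrix.toEuclideanCLM (n := Fin n) (𝕜 := ℝ)).symm
    (P.symm.toContinuousLinearEquiv : Vec n →L[ℝ] Vec n)
  have hU : op U = (P.symm.toContinuousLinearEquiv : Vec n →L[ℝ] Vec n) :=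
    StarAlgEquiv.apply_symm_apply _ _
  have hU' : ∀ x, op U.transpose x = P x := by
    intro x
    rw [← adjoint_op, hU, adjoint_symm_apply]
  refine ⟨U, ?_, hU, hU'⟩
  rw [Matrix.mem_orthogonalGroup_iff]
  have h : op (U * U.transpose) = op 1 := by
    refine ContinuousLinearMap.ext fun x => ?_
    rw [op, op, map_mul, map_one]
    change op U (op U.transpose x) = x
    rw [hU', hU]
    simp
  exact (Matrix.toEuclideanCLM (n := Fin n) (𝕜 := ℝ)).injective h

theorem strongConvexOn_half_norm_sq_add_inner (μ : ℝ) (b : Vec n) :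
    StrongConvexOn Set.univ μ (fun x : Vec n => μ / 2 * ‖x‖ ^ 2 + inner ℝ b x) := by
  rw [strongConvexOn_iff_convex]
  have h : (fun x : Vec n => μ / 2 * ‖x‖ ^ 2 + inner ℝ b x - μ / 2 * ‖x‖ ^ 2) = innerₛₗ ℝ b := by
    funext x
    simp
  rw [h]
  exact LinearMap.convexOn _ convex_univ

theorem rotatedWorstCase_inClass (hL : 0 < θ.Lxy) {U V : Matrix (Fin n) (Fin n) ℝ}
    (hU : U ∈ Matrix.orthogonalGroup (Fin n) ℝ) (hV : V ∈ Matrix.orthogonalGroup (Fin n) ℝ) :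
    (rotatedWorstCase θ U V).InClass θ := by
  have hf : (rotatedWorstCase θ U V).f =
      fun x : Vec n => θ.μx / 2 * ‖x‖ ^ 2 + inner ℝ (0 : Vec n) x := by
    funext x
    simp [rotatedWorstCase, BilinearProblem.rotate, worstCase, norm_op hU]
  have hg : (rotatedWorstCase θ U V).g =
      fun y : Vec n => θ.μy / 2 * ‖y‖ ^ 2 + inner ℝ (op V.transpose (bVec θ n)) y := by
    funext y
    change θ.μy / 2 * ‖op V y‖ ^ 2 + inner ℝ (bVec θ n) (op V y) = _
    rw [norm_op hV, ← adjoint_op, ContinuousLinearMap.adjoint_inner_left]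
  refine ⟨?_, ?_, ?_, ?_, ?_⟩
  · rw [hf]
    exact Continuous.lowerSemicontinuous (by fun_prop)
  · rw [hf]
    exact strongConvexOn_half_norm_sq_add_inner _ _
  · rw [hg]
    exact Continuous.lowerSemicontinuous (by fun_prop)
  · rw [hg]
    exact strongConvexOn_half_norm_sq_add_inner _ _
  · refine ContinuousLinearMap.opNorm_le_bound _ hL.le fun y => ?_
    change ‖ContinuousLinearMap.adjoint (op U) ((θ.Lxy / 2) • op (chainMatrix n) (op V y))‖ ≤ _
    have hUt : U.transpose ∈ Matrix.orthogonalGroup (Fin n) ℝ := by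
      simpa [Matrix.star_eq_conjTranspose] using Unitary.star_mem hU
    rw [adjoint_op, norm_op hUt, norm_smul, Real.norm_of_nonneg (by positivity)]
    have h := (op (chainMatrix n)).le_of_opNorm_le norm_op_chainMatrix_le (op V y)
    rw [norm_op hV] at h
    nlinarith

theorem isSaddlePointOn_rotatedWorstCase_iff (hL : 0 < θ.Lxy) (hx : 0 < θ.μx) (hy : 0 < θ.μy)
    (hn : 0 < n) {U V : Matrix (Fin n) (Fin n) ℝ}
    (hU : U ∈ Matrix.orthogonalGroup (Fin n) ℝ) (hV : V ∈ Matrix.orthogonalGroup (Fin n) ℝ)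
    (x y : Vec n) :
    IsSaddlePointOn Set.univ Set.univ (rotatedWorstCase θ U V).value x y ↔
      x = op U.transpose (saddleX θ n) ∧ y = op V.transpose (saddleY θ n) := by
  have key : IsSaddlePointOn Set.univ Set.univ (rotatedWorstCase θ U V).value x y ↔
      IsSaddlePointOn Set.univ Set.univ (worstCase θ n).value (op U x) (op V y) := by
    constructor
    · intro h x' _ y' _
      have := h (op U.transpose x') (Set.mem_univ _) (op V.transpose y') (Set.mem_univ _)
      rwa [rotatedWorstCase, BilinearProblem.value_rotate, BilinearProblem.value_rotate,
        op_op_transpose hU, op_op_transpose hV] at this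
    · intro h x' _ y' _
      rw [rotatedWorstCase, BilinearProblem.value_rotate, BilinearProblem.value_rotate]
      exact h _ (Set.mem_univ _) _ (Set.mem_univ _)
  rw [key, isSaddlePointOn_worstCase_iff hL hx hy hn]
  constructor
  · rintro ⟨h1, h2⟩
    rw [← h1, ← h2, op_transpose_op hU, op_transpose_op hV]
    exact ⟨rfl, rfl⟩
  · rintro ⟨rfl, rfl⟩
    exact ⟨op_op_transpose hU _, op_op_transpose hV _⟩

theorem norm_sub_op_transpose {V : Matrix (Fin n) (Fin n) ℝ}
    (hV : V ∈ Matrix.orthogonalGroup (Fin n) ℝ) (y z : Vec n) :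
    ‖y - op V.transpose z‖ = ‖op V y - z‖ := by
  rw [← norm_op hV, map_sub, op_op_transpose hV]

theorem dualityGap_rotatedWorstCase_lower_bound (hL : 0 < θ.Lxy) (hx : 0 < θ.μx) (hy : 0 < θ.μy)
    (hn : 0 < n) {U V : Matrix (Fin n) (Fin n) ℝ}
    (hU : U ∈ Matrix.orthogonalGroup (Fin n) ℝ) (hV : V ∈ Matrix.orthogonalGroup (Fin n) ℝ)
    (x y : Vec n) :
    ((θ.μy / 2 * ‖y - op V.transpose (saddleY θ n)‖ ^ 2 : ℝ) : EReal) ≤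
      (rotatedWorstCase θ U V).dualityGap x y := by
  have h := value_sub_value_saddle hL hx hy hn (op U x) (op V y)
  have h0 : 0 ≤ θ.μx / 2 * ‖op U x - saddleX θ n‖ ^ 2 := by positivity
  rw [norm_sub_op_transpose hV]
  calc ((θ.μy / 2 * ‖op V y - saddleY θ n‖ ^ 2 : ℝ) : EReal)
      ≤ (((worstCase θ n).value (op U x) (saddleY θ n) -
          (worstCase θ n).value (saddleX θ n) (op V y) : ℝ) : EReal) := by
        rw [EReal.coe_le_coe_iff]
        linarith
    _ = ((rotatedWorstCase θ U V).value x (op V.transpose (saddleY θ n)) : EReal) -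
          ((rotatedWorstCase θ U V).value (op U.transpose (saddleX θ n)) y : EReal) := by
        rw [rotatedWorstCase, BilinearProblem.value_rotate, BilinearProblem.value_rotate,
          op_op_transpose hU, op_op_transpose hV, EReal.coe_sub]
    _ ≤ _ := EReal.sub_le_sub
        (le_iSup (fun y' => ((rotatedWorstCase θ U V).value x y' : EReal)) _)
        (iInf_le (fun x' => ((rotatedWorstCase θ U V).value x' y : EReal)) _)

/-- The resisting oracle for the instance `worstCase`. -/
theorem exists_resisting_rotation (hL : 0 < θ.Lxy) (hx : 0 < θ.μx) (k : ℕ) (hn : 2 * k + 1 ≤ n)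
    (𝒜 : ProxAlgorithm (Vec n) (Vec n)) :
    ∃ U ∈ Matrix.orthogonalGroup (Fin n) ℝ, ∃ V ∈ Matrix.orthogonalGroup (Fin n) ℝ, ∀ i ≤ k,
      (𝒜.run θ (rotatedWorstCase θ U V) 0 0 i).x ∈
        (krylovX θ n (4 * i - 1)).map (op U.transpose).toLinearMap ∧
      (𝒜.run θ (rotatedWorstCase θ U V) 0 0 i).y ∈
        (krylovY θ n (4 * i - 1)).map (op V.transpose).toLinearMap ∧
      (𝒜.run θ (rotatedWorstCase θ U V) 0 0 i).xOut ∈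
        (krylovX θ n (4 * i + 1)).map (op U.transpose).toLinearMap ∧
      (𝒜.run θ (rotatedWorstCase θ U V) 0 0 i).yOut ∈
        (krylovY θ n (4 * i + 1)).map (op V.transpose).toLinearMap := by
  obtain ⟨P, Q, h⟩ := exists_resisting_isometries 𝒜 θ (worstCase θ n)
    (SX := fun j => krylovX θ n (2 * j)) (SY := fun j => krylovY θ n (2 * j)) (N := n)
    (fun i j hij => krylovX_mono θ (by omega)) (fun i j hij => krylovY_mono θ (by omega))
    (fun j y hy => Submodule.smul_mem _ _ (op_chainMatrix_mem_krylovX θ hy))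
    (fun j x hx => by
      have e : ContinuousLinearMap.adjoint (worstCase θ n).A =
          (θ.Lxy / 2) • op (chainMatrix n) := by
        change ContinuousLinearMap.adjoint ((θ.Lxy / 2) • op (chainMatrix n)) = _
        rw [map_smulₛₗ, adjoint_op_chainMatrix]
        rfl
      rw [e]
      exact Submodule.smul_mem _ _ (op_chainMatrix_mem_krylovY θ hx))
    (fun R x => by simp [worstCase])
    (fun R R' hR y => by
      have hb : R' (bVec θ n) = R (bVec θ n) :=
        hR _ (Submodule.subset_span ⟨0, by norm_num, by simp⟩)
      have e : ∀ T : Vec n ≃ₗᵢ[ℝ] Vec n, inner ℝ (bVec θ n) (T.symm y) =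
          inner ℝ (T (bVec θ n)) y := fun T => by
        rw [← T.inner_map_map, T.apply_symm_apply]
      simp [worstCase, e, hb])
    (fun j hj => ⟨stdVec n (n - 1 - j), stdVec_mem_krylovX hL hx hj, norm_stdVec (by omega),
      fun v hv => by
        rw [inner_stdVec]; exact coord_eq_zero_of_mem_krylovX θ hv (by omega)⟩)
    (fun j hj => ⟨stdVec n j, stdVec_mem_krylovY hL hx hj, norm_stdVec hj,
      fun v hv => by
        rw [inner_stdVec]; exact coord_eq_zero_of_mem_krylovY θ hv le_rfl⟩)
    k hn
  obtain ⟨U, hU, eU, eU'⟩ := exists_orthogonal_op_eq P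
  obtain ⟨V, hV, eV, eV'⟩ := exists_orthogonal_op_eq Q
  have hrot : rotatedWorstCase θ U V = (worstCase θ n).rotateSymm P Q := by
    rw [rotatedWorstCase, eU, eV]
  refine ⟨U, hU, V, hV, fun i hi => ?_⟩
  obtain ⟨⟨z₁, hz₁, e₁⟩, ⟨z₂, hz₂, e₂⟩, ⟨z₃, hz₃, e₃⟩, ⟨z₄, hz₄, e₄⟩⟩ := h i hi
  rw [hrot]
  have hX : krylovX θ n (2 * (2 * i - 1)) = krylovX θ n (4 * i - 1) := by
    unfold krylovX
    rw [show 2 * (2 * i - 1) / 2 = (4 * i - 1) / 2 by omega]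
  have hY : krylovY θ n (2 * (2 * i)) = krylovY θ n (4 * i - 1) := by
    unfold krylovY
    rw [show (2 * (2 * i) + 1) / 2 = (4 * i - 1 + 1) / 2 by omega]
  refine ⟨⟨z₁, ?_, (eU' _).trans e₁⟩, ⟨z₂, ?_, (eV' _).trans e₂⟩, ⟨z₃, ?_, (eU' _).trans e₃⟩,
    ⟨z₄, ?_, (eV' _).trans e₄⟩⟩
  · exact hX ▸ hz₁
  · exact hY ▸ hz₂
  · exact krylovX_mono θ (by omega) hz₃
  · have e : krylovY θ n (2 * (2 * i + 1)) = krylovY θ n (4 * i + 1) := by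
      unfold krylovY
      rw [show (2 * (2 * i + 1) + 1) / 2 = (4 * i + 1 + 1) / 2 by omega]
    exact e ▸ hz₄

theorem norm_sub_op_transpose_saddleY_lower_bound (ha : 0 < condInv θ) {k s : ℕ}
    (hs : qRate θ ^ (2 * s) ≤ 1 / 2) (hn : 2 * k + 1 + 2 * s ≤ n) {V : Matrix (Fin n) (Fin n) ℝ}
    (hV : V ∈ Matrix.orthogonalGroup (Fin n) ℝ) {y : Vec n}
    (hy : y ∈ (krylovY θ n (4 * k + 1)).map (op V.transpose).toLinearMap) :
    qRate θ ^ (4 * k + 2) / 16 * ‖saddleY θ n‖ ^ 2 ≤ ‖y - op V.transpose (saddleY θ n)‖ ^ 2 := by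
  obtain ⟨z, hz, rfl⟩ := hy
  have hz' : z ∈ krylovY θ n (2 * (2 * k + 1)) := krylovY_mono θ (by omega) hz
  have h := norm_sub_saddleY_lower_bound ha hs hn hz'
  rw [norm_sub_op_transpose hV]
  change _ ≤ ‖op V (op V.transpose z) - _‖ ^ 2
  rw [op_op_transpose hV]
  convert h using 3
  ring

theorem exists_qRate_pow_le_half (ha : 0 < condInv θ) : ∃ s : ℕ, qRate θ ^ (2 * s) ≤ 1 / 2 := by
  have hq0 := qRate_pos ha.le
  have hq1 := qRate_lt_one ha
  obtain ⟨s, hs⟩ := exists_pow_lt_of_lt_one (by norm_num : (0 : ℝ) < 1 / 2) hq1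
  exact ⟨s, (pow_le_pow_of_le_one hq0.le hq1.le (by omega)).trans hs.le⟩

/-- A geometric lower bound on the accuracy turns into a logarithmic bound on the number of
iterations. -/
theorem iterations_lower_bound (hL : 0 < θ.Lxy) (hx : 0 < θ.μx) (hy : 0 < θ.μy) {C : ℝ}
    (hC : 0 < C) :
    ∃ ε₀ : ℝ, 0 < ε₀ ∧ ∀ ε : ℝ, 0 < ε → ε < ε₀ → ∀ k : ℕ,
      θ.μy / 128 * qRate θ ^ (4 * k + 4) ≤ C * ε →
      1 / 16 * √(θ.Lxy ^ 2 / (θ.μx * θ.μy)) * Real.log (1 / ε) ≤ k := by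
  have ha := condInv_pos hL hx hy
  have hq0 := qRate_pos ha.le
  have hlog := neg_log_qRate_le ha.le
  set a := condInv θ with ha'
  have hκ : √(θ.Lxy ^ 2 / (θ.μx * θ.μy)) = (√a)⁻¹ := by
    rw [← Real.sqrt_inv, ha', condInv, inv_div]
  have hsa : 0 < √a := Real.sqrt_pos.2 ha
  set D := 2 * (8 * √a - Real.log (θ.μy / 128 / C)) with hD
  refine ⟨Real.exp (-D), Real.exp_pos _, fun ε hε hε' k hk => ?_⟩
  have h1 : D ≤ Real.log (1 / ε) := by
    rw [one_div, Real.log_inv]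
    have := Real.log_lt_log hε hε'
    rw [Real.log_exp] at this
    linarith
  have h2 : Real.log (θ.μy / 128 / C) + (4 * k + 4) * Real.log (qRate θ) ≤ Real.log ε := by
    have : θ.μy / 128 / C * qRate θ ^ (4 * k + 4) ≤ ε := by
      rw [div_mul_eq_mul_div, div_le_iff₀ hC]
      linarith
    have h := Real.log_le_log (by positivity) this
    rw [Real.log_mul (by positivity) (by positivity), Real.log_pow] at h
    push_cast at h
    exact h
  have h3 : Real.log (1 / ε) = -Real.log ε := by rw [one_div, Real.log_inv]
  have h4 : (4 * (k : ℝ) + 4) * -Real.log (qRate θ) ≤ (4 * k + 4) * (2 * √a) :=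
    mul_le_mul_of_nonneg_left hlog (by positivity)
  have h5 : Real.log (1 / ε) ≤ 16 * k * √a := by nlinarith
  rw [hκ, mul_assoc, inv_mul_eq_div, one_div_mul_eq_div, div_div, div_le_iff₀ (by positivity)]
  nlinarith

end Rotation

end SaddleProx

theorem mainTheorem3 :
    (∀ θ : SaddleProx.ClassParams, 0 < θ.Lxy → 0 < θ.μx → 0 < θ.μy →
      ∀ k : ℕ, ∃ N : ℕ, ∀ n : ℕ, N ≤ n →
      -- `(xs, ys)` is the unique saddle point of the unrotated instance
      ∃ xs ys : SaddleProx.Vec n,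
        (∀ x y : SaddleProx.Vec n,
          IsSaddlePointOn Set.univ Set.univ (SaddleProx.worstCase θ n).value x y ↔
            x = xs ∧ y = ys) ∧
        ∀ 𝒜 : SaddleProx.ProxAlgorithm (SaddleProx.Vec n) (SaddleProx.Vec n),
        ∃ U ∈ Matrix.orthogonalGroup (Fin n) ℝ, ∃ V ∈ Matrix.orthogonalGroup (Fin n) ℝ,
          (SaddleProx.rotatedWorstCase θ U V).InClass θ ∧
          (∀ x y : SaddleProx.Vec n,
            IsSaddlePointOn Set.univ Set.univ (SaddleProx.rotatedWorstCase θ U V).value x y ↔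
              x = SaddleProx.op U.transpose xs ∧ y = SaddleProx.op V.transpose ys) ∧
          (∀ i : ℕ, i ≤ k →
            (𝒜.run θ (SaddleProx.rotatedWorstCase θ U V) 0 0 i).x ∈
                (SaddleProx.krylovX θ n (4 * k - 1)).map
                  (SaddleProx.op U.transpose).toLinearMap ∧
            (𝒜.run θ (SaddleProx.rotatedWorstCase θ U V) 0 0 i).y ∈
                (SaddleProx.krylovY θ n (4 * k - 1)).map
                  (SaddleProx.op V.transpose).toLinearMap) ∧
          (𝒜.run θ (SaddleProx.rotatedWorstCase θ U V) 0 0 k).xOut ∈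
              (SaddleProx.krylovX θ n (4 * k + 1)).map
                (SaddleProx.op U.transpose).toLinearMap ∧
          (𝒜.run θ (SaddleProx.rotatedWorstCase θ U V) 0 0 k).yOut ∈
              (SaddleProx.krylovY θ n (4 * k + 1)).map
                (SaddleProx.op V.transpose).toLinearMap ∧
          SaddleProx.qRate θ ^ (4 * k + 2) / 16 * ‖ys - 0‖ ^ 2 ≤
            ‖(𝒜.run θ (SaddleProx.rotatedWorstCase θ U V) 0 0 k).yOut -
              SaddleProx.op V.transpose ys‖ ^ 2) ∧
    -- iteration complexity, with an absolute constant `c`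
    (∃ c : ℝ, 0 < c ∧
      ∀ θ : SaddleProx.ClassParams, 0 < θ.Lxy → 0 < θ.μx → 0 < θ.μy →
      ∀ C : ℝ, 0 < C → ∃ ε₀ : ℝ, 0 < ε₀ ∧ ∀ ε : ℝ, 0 < ε → ε < ε₀ →
      ∃ N : ℕ, ∀ n : ℕ, N ≤ n →
      ∀ 𝒜 : SaddleProx.ProxAlgorithm (SaddleProx.Vec n) (SaddleProx.Vec n),
      ∃ U ∈ Matrix.orthogonalGroup (Fin n) ℝ, ∃ V ∈ Matrix.orthogonalGroup (Fin n) ℝ,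
        (SaddleProx.rotatedWorstCase θ U V).InClass θ ∧
        ∀ k : ℕ,
          (SaddleProx.rotatedWorstCase θ U V).dualityGap
              (𝒜.run θ (SaddleProx.rotatedWorstCase θ U V) 0 0 k).xOut
              (𝒜.run θ (SaddleProx.rotatedWorstCase θ U V) 0 0 k).yOut ≤ ((C * ε : ℝ) : EReal) →
          c * √(θ.Lxy ^ 2 / (θ.μx * θ.μy)) * Real.log (1 / ε) ≤ (k : ℝ)) := by
  refine ⟨fun θ hL hx hy k => ?_, 1 / 16, by norm_num, fun θ hL hx hy C hC => ?_⟩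
  · have ha := SaddleProx.condInv_pos hL hx hy
    obtain ⟨s, hs⟩ := SaddleProx.exists_qRate_pow_le_half ha
    refine ⟨2 * k + 1 + 2 * s, fun n hn => ⟨SaddleProx.saddleX θ n, SaddleProx.saddleY θ n,
      SaddleProx.isSaddlePointOn_worstCase_iff hL hx hy (by omega), fun 𝒜 => ?_⟩⟩
    obtain ⟨U, hU, V, hV, h⟩ :=
      SaddleProx.exists_resisting_rotation (θ := θ) hL hx k (by omega : 2 * k + 1 ≤ n) 𝒜
    refine ⟨U, hU, V, hV, SaddleProx.rotatedWorstCase_inClass hL hU hV,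
      SaddleProx.isSaddlePointOn_rotatedWorstCase_iff hL hx hy (by omega) hU hV,
      fun i hi => ⟨?_, ?_⟩, (h k le_rfl).2.2.1, (h k le_rfl).2.2.2, ?_⟩
    · exact Submodule.map_mono (SaddleProx.krylovX_mono θ (by omega)) (h i hi).1
    · exact Submodule.map_mono (SaddleProx.krylovY_mono θ (by omega)) (h i hi).2.1
    · rw [sub_zero]
      exact SaddleProx.norm_sub_op_transpose_saddleY_lower_bound ha hs hn hV (h k le_rfl).2.2.2
  · have ha := SaddleProx.condInv_pos hL hx hy
    have hq0 := SaddleProx.qRate_pos ha.le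
    obtain ⟨s, hs⟩ := SaddleProx.exists_qRate_pow_le_half ha
    obtain ⟨ε₀, hε₀, hiter⟩ := SaddleProx.iterations_lower_bound hL hx hy hC
    refine ⟨ε₀, hε₀, fun ε hε hε' => ?_⟩
    obtain ⟨K, hK⟩ :=
      exists_nat_ge (1 / 16 * √(θ.Lxy ^ 2 / (θ.μx * θ.μy)) * Real.log (1 / ε))
    refine ⟨2 * K + 1 + 2 * s, fun n hn 𝒜 => ?_⟩
    obtain ⟨U, hU, V, hV, h⟩ :=
      SaddleProx.exists_resisting_rotation (θ := θ) hL hx K (by omega : 2 * K + 1 ≤ n) 𝒜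
    refine ⟨U, hU, V, hV, SaddleProx.rotatedWorstCase_inClass hL hU hV, fun k hk => ?_⟩
    rcases le_total K k with hKk | hkK
    · exact hK.trans (by exact_mod_cast hKk)
    · refine hiter ε hε hε' k ?_
      have hgap := (SaddleProx.dualityGap_rotatedWorstCase_lower_bound hL hx hy (by omega) hU hV
        _ _).trans hk
      rw [EReal.coe_le_coe_iff] at hgap
      refine le_trans ?_ hgap
      have hdist := SaddleProx.norm_sub_op_transpose_saddleY_lower_bound ha hs
        (by omega : 2 * k + 1 + 2 * s ≤ n) hV (h k hkK).2.2.2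
      have hnorm := pow_le_pow_left₀ (by positivity)
        (SaddleProx.norm_saddleY_lower_bound ha (by omega : 0 < n)) 2
      calc θ.μy / 128 * SaddleProx.qRate θ ^ (4 * k + 4)
          = θ.μy / 2 * (SaddleProx.qRate θ ^ (4 * k + 2) / 16 * (SaddleProx.qRate θ / 2) ^ 2) := by
            ring
        _ ≤ _ := mul_le_mul_of_nonneg_left
            ((mul_le_mul_of_nonneg_left hnorm (by positivity)).trans hdist) (by positivity)
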